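/- Let $F=\mathbb{Q}(t)$ and let $V=F[p_1,p_2,\ldots]$ be the ring of symmetric functions over $F$, where $p_k$ is the $k$-th power sum. For a partition $\lambda$ with $m_i(\lambda)$ parts equal to $i$ put $p_\lambda=p_{\lambda_1}p_{\lambda_2}\cdots$ and $$z_\lambda(t)=\prod_{i\ge 1}\frac{i^{m_i(\lambda)}\,m_i(\lambda)!}{(1-t^i)^{m_i(\lambda)}},$$ and let $\langle\ ,\ \rangle$ be the $F$-bilinear form on $V$ with $\langle p_\lambda,p_\mu\rangle=\delta_{\lambda\mu}z_\lambda(t)$. Let $q_n=\sum_{\lambda\vdash n}z_\lambda(t)^{-1}p_\lambda$ for $n\ge 0$ and $q_n=0$ for $n<0$, and put $q_\alpha=q_{\alpha_1}\cdots q_{\alpha_l}$ for $\alpha\in\mathbb{Z}^l$. Let $$Q_\nu=Q_\nu(t)=\prod_{i<j}\frac{1-R_{ij}}{1-tR_{ij}}\;q_{\nu_1}\cdots q_{\nu_l}$$ be the Hall-Littlewood function of a partition $\nu=(\nu_1,\ldots,\nu_l)$ with $l$ nonzero parts, where the product is over $1\le i<j\le l$, is expanded in powers of the raising operators $R_{ij}$,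 and $R_{ij}$ acts on indices by $R_{ij}\,q_\alpha=q_{(\ldots,\alpha_i+1,\ldots,\alpha_j-1,\ldots)}$. For partitions $\nu,\mu\vdash n$ let $B^\nu_\mu(t)=\langle Q_\nu,q_\mu\rangle$. Then for every $n\ge 0$: 1. If $\nu,\mu\vdash n$ and $\mu>\nu$ in the dominance order, then $B^\nu_\mu(t)=0$. 2. The matrix $\big(B^\nu_\mu(t)\big)_{\mu,\nu\vdash n}$ (rows indexed by $\mu$, columns by $\nu$) is triangular: whenever the partitions of $n$ are listed in a total order that extends the dominance order, $B^\nu_\mu(t)=0$ for all $\mu$ that are larger than $\nu$ in this total order. -/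

import Mathlib

namespace HallLittlewood

noncomputable section

/-- The ground field `F = ℚ(t)`. -/
abbrev F : Type := RatFunc ℚ

/-- The indeterminate `t`. -/
def t : F := RatFunc.X

/-- The ring `V = Λ_F` of symmetric functions over `F = ℚ(t)`, as the polynomial ring
`F[p₁, p₂, …]` in the power sums: the variable `X k` is the power sum `p_k`, `k ≥ 1`. -/
abbrev V : Type := MvPolynomial ℕ+ F

/-- The power sum `p_k`, for a positive integer `k` (the value at `k = 0` is never used). -/
def p (k : ℕ) : V := MvPolynomial.X k.toPNat'

/-- The power sum product `p_lam = p_{lam₁} p_{lam₂} ⋯`. -/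
def pProd {n : ℕ} (lam : n.Partition) : V := (lam.parts.map p).prod

/-- The exponent vector `i ↦ m_i(lam)` of multiplicities of the parts of a partition. -/
def mult {n : ℕ} (lam : n.Partition) : ℕ+ →₀ ℕ :=
  Multiset.toFinsupp (lam.parts.map Nat.toPNat')

/-- `z_m(t) = ∏_i i ^ {m_i} (m_i)! / (1 - t^i) ^ {m_i}`, for a vector `m` of multiplicities. -/
def zt (m : ℕ+ →₀ ℕ) : F :=
  m.prod fun i k => (((i : ℕ) : F) ^ k * (k.factorial : F)) / (1 - t ^ (i : ℕ)) ^ k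

/-- The Hall-Littlewood bilinear form on `V`: the bilinear form with
`⟨p^m, p^{m'}⟩ = δ_{m m'} z_m(t)` on the basis of power sum monomials. -/
def form : V →ₗ[F] V →ₗ[F] F :=
  (MvPolynomial.basisMonomials ℕ+ F).constr F fun m => zt m • MvPolynomial.lcoeff F m

theorem form_monomial (m m' : ℕ+ →₀ ℕ) :
    form (MvPolynomial.monomial m 1) (MvPolynomial.monomial m' 1) =
      if m = m' then zt m else 0 := by
  have h := (MvPolynomial.basisMonomials ℕ+ F).constr_basis F
    (fun m => zt m • MvPolynomial.lcoeff F m) m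
  rw [MvPolynomial.coe_basisMonomials] at h
  unfold form
  rw [h]
  simp [MvPolynomial.coeff_monomial, eq_comm]

theorem pProd_eq_monomial {n : ℕ} (lam : n.Partition) :
    pProd lam = MvPolynomial.monomial (mult lam) 1 := by
  unfold pProd mult p
  generalize lam.parts = s
  induction s using Multiset.induction_on with
  | empty => simp
  | cons a s ih =>
    rw [Multiset.map_cons, Multiset.prod_cons, ih, Multiset.map_cons,
      ← Multiset.singleton_add, map_add, Multiset.toFinsupp_singleton,
      MvPolynomial.X, MvPolynomial.monomial_mul, one_mul]

/-- The symmetric function `q_n = ∑_{lam ⊢ n} z_lam(t)⁻¹ p_lam`. -/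
def qNat (n : ℕ) : V := ∑ lam : n.Partition, (zt (mult lam))⁻¹ • pProd lam

/-- `q_k` for an integer `k`, with the convention `q_k = 0` for `k < 0`. -/
def q (k : ℤ) : V := if k < 0 then 0 else qNat k.toNat

/-- `q_mu = q_{mu₁} q_{mu₂} ⋯` for a partition `mu`. -/
def qProd {n : ℕ} (mu : n.Partition) : V := (mu.parts.map qNat).prod

/-- The pairs of positions `(i, j)` with `i < j` in a sequence of length `l`. -/
abbrev Pairs (l : ℕ) : Type := {ij : Fin l × Fin l // ij.1 < ij.2}

/-- The result of applying `∏_{i < j} R_{ij} ^ {a_{ij}}` to an index `α ∈ ℤ^l`, where the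
raising operator `R_{ij}` adds `1` to `α_i` and subtracts `1` from `α_j`. -/
def raise {l : ℕ} (α : Fin l → ℤ) (a : Pairs l → ℕ) : Fin l → ℤ :=
  α + ∑ ij : Pairs l, (a ij : ℤ) • (Pi.single ij.1.1 1 - Pi.single ij.1.2 1)

/-- The coefficient of `R ^ k` in the expansion of `(1 - R) / (1 - t R)` in powers of `R`. -/
def raiseCoeff (k : ℕ) : F :=
  PowerSeries.coeff k
    ((1 - PowerSeries.X) * (1 - PowerSeries.C t * PowerSeries.X)⁻¹ : PowerSeries F)

/-- `∏_{i < j} (1 - R_{ij}) / (1 - t R_{ij}) q_α` for `α ∈ ℤ^l`. Only finitely many terms of the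
sum are nonzero, see `raisingTerm_finite`. -/
def Qseq {l : ℕ} (α : Fin l → ℤ) : V :=
  ∑ᶠ a : Pairs l → ℕ, (∏ ij, raiseCoeff (a ij)) • ∏ k, q (raise α a k)

theorem raise_tail {l : ℕ} (α : Fin l → ℤ) (a : Pairs l → ℕ) (j : Fin l) :
    ∑ k ∈ Finset.Ici j, raise α a k =
      ∑ k ∈ Finset.Ici j, α k -
        ∑ ij : Pairs l, if ij.1.1 < j ∧ j ≤ ij.1.2 then (a ij : ℤ) else 0 := by
  simp only [raise, Pi.add_apply, Finset.sum_apply, Pi.smul_apply, Pi.sub_apply,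
    Finset.sum_add_distrib]
  rw [sub_eq_add_neg]
  congr 1
  rw [Finset.sum_comm, ← Finset.sum_neg_distrib]
  refine Finset.sum_congr rfl fun ij _ => ?_
  have hlt := ij.2
  rw [← Finset.smul_sum, Finset.sum_sub_distrib]
  simp only [Pi.single_apply, Finset.sum_ite_eq', Finset.mem_Ici]
  by_cases h1 : j ≤ ij.1.1
  · have h2 : j ≤ ij.1.2 := h1.trans hlt.le
    simp [h1, h2]
  · by_cases h2 : j ≤ ij.1.2 <;> simp [h1, h2, not_le.mp h1]

theorem raisingTerm_finite {l : ℕ} (α : Fin l → ℤ) :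
    (Function.support fun a : Pairs l → ℕ =>
      (∏ ij, raiseCoeff (a ij)) • ∏ k, q (raise α a k)).Finite := by
  refine Set.Finite.subset
    (Set.finite_Iic (fun ij : Pairs l => (∑ k ∈ Finset.Ici ij.1.2, α k).toNat)) ?_
  intro a ha ij
  have hpos : ∀ k, 0 ≤ raise α a k := by
    intro k
    by_contra hk
    refine ha ?_
    have : ∏ k, q (raise α a k) = 0 :=
      Finset.prod_eq_zero (Finset.mem_univ k) (by simp [q, not_le.mp hk])
    simp [this]
  have h1 := raise_tail α a ij.1.2
  have h2 : 0 ≤ ∑ k ∈ Finset.Ici ij.1.2, raise α a k := Finset.sum_nonneg fun k _ => hpos k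
  have h3 : (a ij : ℤ) ≤
      ∑ ij' : Pairs l, if ij'.1.1 < ij.1.2 ∧ ij.1.2 ≤ ij'.1.2 then (a ij' : ℤ) else 0 := by
    have := Finset.single_le_sum (s := Finset.univ)
      (f := fun ij' : Pairs l =>
        if ij'.1.1 < ij.1.2 ∧ ij.1.2 ≤ ij'.1.2 then (a ij' : ℤ) else 0)
      (fun _ _ => by split_ifs <;> positivity) (Finset.mem_univ ij)
    simpa [ij.2] using this
  show a ij ≤ (∑ k ∈ Finset.Ici ij.1.2, α k).toNat
  omega

/-- The parts of a partition, in weakly decreasing order. -/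
def partList {n : ℕ} (lam : n.Partition) : List ℕ := lam.parts.sort (· ≥ ·)

/-- The Hall-Littlewood function `Q_lam(t) = ∏_{i < j} (1 - R_{ij}) / (1 - t R_{ij}) q_lam`. -/
def Q {n : ℕ} (lam : n.Partition) : V :=
  Qseq fun k : Fin (partList lam).length => ((partList lam).get k : ℤ)

/-- The bitrace coefficient `B^nu_mu(t) = ⟨Q_nu, q_mu⟩`. -/
def B {n : ℕ} (nu mu : n.Partition) : F := form (Q nu) (qProd mu)

/-- The matrix of the coefficients `B^nu_mu(t)`, with rows indexed by `mu`, columns by `nu`. -/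
def bitraceMatrix (n : ℕ) : Matrix n.Partition n.Partition F :=
  Matrix.of fun mu nu => B nu mu

/-- Dominance order: `nu ≤ mu` if `nu₁ + ⋯ + nu_i ≤ mu₁ + ⋯ + mu_i` for all `i`. -/
def DomLE {n : ℕ} (nu mu : n.Partition) : Prop :=
  ∀ i : ℕ, ((partList nu).take i).sum ≤ ((partList mu).take i).sum

/-- Strict dominance order. -/
def DomLT {n : ℕ} (nu mu : n.Partition) : Prop := DomLE nu mu ∧ nu ≠ mu

end

end HallLittlewood

namespace HallLittlewood

noncomputable section

open Finset

/-! ### The scalar product and the functions `q_n` -/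

/-! The value `⟨f, q_β⟩` is the coefficient of `y^β` in the specialization `f(y_1, …, y_l)`
(`form_prod_qNat`). So `B^ν_μ` is the coefficient of `y^μ` in `Q_ν(y)`, and it suffices to bound the
degree of `Q_ν(y)` in each set `T` of variables.

At variables indexed by `S`, the `q_n` have generating series `H_S(X) = ∏ (1 - t y_i X)/(1 - y_i X)`
(`ev_qNat`). Deleting `y_i` multiplies `H_S` by `(1 - R)/(1 - tR)` with `R = y_i X`, the factor
attached to a raising operator. Expanding the first `q` by partial fractions therefore gives
(`ev_Qseq_cons`), for `r > 0`, `Q_(r,α)(y_S) = ∑_{i ∈ S} c_i y_i^r Q_α(y_{S∖i})`, where `c_i = (1 -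
t) ∏_{j ≠ i} (y_i - t y_j)/(y_i - y_j)`.

Scale the variables in `T` by a new variable and take degrees at infinity. Each `c_i` has degree at
most `0`, while `y_i^r` contributes `r` exactly when `i ∈ T`. By induction `Q_ν` has degree at most
the sum of its `|S ∩ T|` largest parts (`valuation_ev_Qseq_le`). With `T` the first `k` variables, a
nonzero coefficient of `y^μ` forces `μ_1 + ⋯ + μ_k ≤ ν_1 + ⋯ + ν_k`. Hence `B^ν_μ = 0` unless `μ ≤
ν` in dominance order (`B_eq_zero_of_not_domLE`), which contains both claims. -/

theorem derivation_prod {R A ι : Type*} [CommSemiring R] [CommSemiring A] [Algebra R A]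
    [DecidableEq ι] (D : Derivation R A A) (s : Finset ι) (f : ι → A) :
    D (∏ i ∈ s, f i) = ∑ i ∈ s, D (f i) * ∏ j ∈ s.erase i, f j := by
  induction s using Finset.induction_on with
  | empty => simp
  | insert a s ha ih =>
    rw [prod_insert ha, Derivation.leibniz, sum_insert ha, erase_insert ha, ih, smul_eq_mul,
      smul_eq_mul, mul_sum, add_comm, mul_comm]
    congr 1
    refine sum_congr rfl fun i hi => ?_
    have hne : a ≠ i := fun h => ha (h ▸ hi)
    rw [erase_insert_of_ne hne, prod_insert (fun h => ha (mem_of_mem_erase h))]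
    ring

theorem one_sub_t_pow_ne_zero (k : ℕ+) : (1 : F) - t ^ (k : ℕ) ≠ 0 := by
  intro h
  have h1 : (t : F) ^ (k : ℕ) = 1 := (sub_eq_zero.mp h).symm
  unfold t at h1
  rw [← RatFunc.algebraMap_X, ← map_pow, ← map_one (algebraMap (Polynomial ℚ) (RatFunc ℚ))] at h1
  have h2 := RatFunc.algebraMap_injective ℚ h1
  have h3 := congrArg Polynomial.natDegree h2
  simp at h3

theorem zt_ne_zero (m : ℕ+ →₀ ℕ) : zt m ≠ 0 := by
  unfold zt
  refine Finset.prod_ne_zero_iff.mpr fun i _ => ?_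
  refine div_ne_zero (mul_ne_zero (pow_ne_zero _ ?_) ?_) (pow_ne_zero _ (one_sub_t_pow_ne_zero i))
  · exact_mod_cast i.ne_zero
  · exact_mod_cast (m i).factorial_ne_zero

/-- Only the factor at `k` changes. This ratio is what drives both the derivative of `q_n` and the
adjoint of multiplication by `p_k`. -/
theorem zt_add_single (m : ℕ+ →₀ ℕ) (k : ℕ+) :
    zt (m + Finsupp.single k 1) * (1 - t ^ (k : ℕ)) = ((k : ℕ) : F) * ((m k : F) + 1) * zt m := by
  classical
  have hs : ∀ m' : ℕ+ →₀ ℕ, m'.support ⊆ insert k m.support → zt m' =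
      ((((k : ℕ) : F) ^ (m' k) * ((m' k).factorial : F)) / (1 - t ^ (k : ℕ)) ^ (m' k)) *
      ∏ i ∈ m.support.erase k,
        (((i : ℕ) : F) ^ (m' i) * ((m' i).factorial : F)) / (1 - t ^ (i : ℕ)) ^ (m' i) := by
    intro m' h
    unfold zt
    rw [Finsupp.prod_of_support_subset _ h _ (by simp),
      show insert k m.support = insert k (m.support.erase k) by ext; simp; tauto,
      prod_insert (notMem_erase _ _)]
  rw [hs m (subset_insert _ _), hs (m + Finsupp.single k 1)]
  · have h : ∏ i ∈ m.support.erase k,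
          (((i : ℕ) : F) ^ ((m + Finsupp.single k 1 : ℕ+ →₀ ℕ) i) *
            (((m + Finsupp.single k 1 : ℕ+ →₀ ℕ) i).factorial : F)) /
            (1 - t ^ (i : ℕ)) ^ ((m + Finsupp.single k 1 : ℕ+ →₀ ℕ) i) =
        ∏ i ∈ m.support.erase k,
          (((i : ℕ) : F) ^ (m i) * ((m i).factorial : F)) / (1 - t ^ (i : ℕ)) ^ (m i) := by
      refine prod_congr rfl fun i hi => ?_
      have : (m + Finsupp.single k 1 : ℕ+ →₀ ℕ) i = m i := by
        simp [(ne_of_mem_erase hi).symm]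
      rw [this]
    rw [h]
    have h1 : (m + Finsupp.single k 1 : ℕ+ →₀ ℕ) k = m k + 1 := by simp
    have h2 := one_sub_t_pow_ne_zero k
    rw [h1, Nat.factorial_succ]
    push_cast
    field_simp
    ring
  · refine Finsupp.support_add.trans (union_subset (subset_insert _ _) ?_)
    exact Finsupp.support_single_subset.trans (by simp)

/-- The degree `∑ i m_i` of the monomial `∏ p_i ^ {m_i}`. -/
def wt (m : ℕ+ →₀ ℕ) : ℕ := m.sum fun i k => k * (i : ℕ)

theorem wt_add_single (m : ℕ+ →₀ ℕ) (k : ℕ+) :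
    wt (m + Finsupp.single k 1) = wt m + k := by
  unfold wt
  rw [Finsupp.sum_add_index' (by simp) (by intros; ring)]
  simp

theorem sum_map_toMultiset (m : ℕ+ →₀ ℕ) :
    ((Finsupp.toMultiset m).map fun i : ℕ+ => (i : ℕ)).sum = wt m := by
  induction m using Finsupp.induction_linear with
  | zero => simp [wt]
  | add f g hf hg =>
    rw [map_add, Multiset.map_add, Multiset.sum_add, hf, hg]
    exact (Finsupp.sum_add_index' (by simp) (by intros; ring)).symm
  | single a b => simp [wt, Multiset.map_nsmul, Multiset.sum_nsmul]

theorem map_coe_map_toPNat' {n : ℕ} (lam : n.Partition) :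
    (lam.parts.map Nat.toPNat').map (fun i : ℕ+ => (i : ℕ)) = lam.parts := by
  rw [Multiset.map_map]
  conv_rhs => rw [← Multiset.map_id lam.parts]
  refine Multiset.map_congr rfl fun x hx => ?_
  simp [lam.parts_pos hx]

theorem toMultiset_mult {n : ℕ} (lam : n.Partition) :
    Finsupp.toMultiset (mult lam) = lam.parts.map Nat.toPNat' := by
  simp [mult]

theorem wt_mult {n : ℕ} (lam : n.Partition) : wt (mult lam) = n := by
  rw [← sum_map_toMultiset, toMultiset_mult, map_coe_map_toPNat', lam.parts_sum]

theorem mult_injective (n : ℕ) : Function.Injective (mult : n.Partition → ℕ+ →₀ ℕ) := by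
  intro a b h
  ext1
  rw [← map_coe_map_toPNat' a, ← map_coe_map_toPNat' b, ← toMultiset_mult, ← toMultiset_mult, h]

theorem exists_mult_eq (m : ℕ+ →₀ ℕ) : ∃ lam : (wt m).Partition, mult lam = m := by
  refine ⟨⟨(Finsupp.toMultiset m).map fun i : ℕ+ => (i : ℕ), ?_, sum_map_toMultiset m⟩, ?_⟩
  · intro i hi
    obtain ⟨j, -, rfl⟩ := Multiset.mem_map.mp hi
    exact j.pos
  · simp [mult, Multiset.map_map]

/-- Partitions of `n` correspond bijectively, via multiplicities, to exponent vectors of weight `n`.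
-/
theorem coeff_qNat (n : ℕ) (m : ℕ+ →₀ ℕ) :
    MvPolynomial.coeff m (qNat n) = if wt m = n then (zt m)⁻¹ else 0 := by
  classical
  unfold qNat
  simp only [MvPolynomial.coeff_sum, MvPolynomial.coeff_smul, pProd_eq_monomial,
    MvPolynomial.coeff_monomial, smul_eq_mul, mul_ite, mul_one, mul_zero]
  split_ifs with h
  · subst h
    obtain ⟨lam, hlam⟩ := exists_mult_eq m
    rw [sum_eq_single lam]
    · simp [hlam]
    · intro b _ hb
      exact if_neg fun hm => hb (mult_injective _ (hm.trans hlam.symm))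
    · simp
  · refine sum_eq_zero fun lam _ => if_neg fun hm => h ?_
    rw [← hm, wt_mult]

theorem pderiv_qNat (n : ℕ) (k : ℕ+) :
    ((k : ℕ) : F) • MvPolynomial.pderiv k (qNat n) =
      (1 - t ^ (k : ℕ)) • (if (k : ℕ) ≤ n then qNat (n - k) else 0) := by
  ext m
  rw [MvPolynomial.coeff_smul, MvPolynomial.coeff_smul, MvPolynomial.coeff_pderiv, coeff_qNat,
    wt_add_single, smul_eq_mul, smul_eq_mul, apply_ite (MvPolynomial.coeff m), coeff_qNat,
    MvPolynomial.coeff_zero]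
  by_cases h : wt m + k = n
  · rw [if_pos h, if_pos (by omega), if_pos (by omega)]
    have h1 := zt_add_single m k
    have h2 := zt_ne_zero m
    have h3 := zt_ne_zero (m + Finsupp.single k 1)
    field_simp
    linear_combination -h1
  · rw [if_neg h]
    by_cases hk : (k : ℕ) ≤ n
    · rw [if_pos hk, if_neg (by omega)]; simp
    · rw [if_neg hk]; simp

/-! ### Adjointness of `p_k` and `∂/∂p_k`, and coefficient extraction -/

theorem form_monomial_left (m : ℕ+ →₀ ℕ) (g : V) :
    form (MvPolynomial.monomial m 1) g = zt m * MvPolynomial.coeff m g := by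
  have h := (MvPolynomial.basisMonomials ℕ+ F).constr_basis F
    (fun m => zt m • MvPolynomial.lcoeff F m) m
  rw [MvPolynomial.coe_basisMonomials] at h
  unfold form
  rw [h]
  simp

/-- Multiplication by `p_k` is adjoint to `k/(1 - t^k) ∂/∂p_k`; denominators are cleared. -/
theorem form_X_mul (k : ℕ+) (f g : V) :
    (1 - t ^ (k : ℕ)) * form (f * MvPolynomial.X k) g =
      ((k : ℕ) : F) * form f (MvPolynomial.pderiv k g) := by
  induction f using MvPolynomial.induction_on' with
  | add f₁ f₂ h₁ h₂ =>
    rw [add_mul, map_add, map_add, LinearMap.add_apply, LinearMap.add_apply, mul_add, mul_add,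
      h₁, h₂]
  | monomial m c =>
    have hc : (MvPolynomial.monomial m c : V) = c • MvPolynomial.monomial m 1 := by
      rw [MvPolynomial.smul_monomial, smul_eq_mul, mul_one]
    rw [hc, smul_mul_assoc, map_smul, map_smul, LinearMap.smul_apply, LinearMap.smul_apply,
      MvPolynomial.X, MvPolynomial.monomial_mul, mul_one, form_monomial_left, form_monomial_left,
      MvPolynomial.coeff_pderiv, smul_eq_mul, smul_eq_mul]
    linear_combination c * MvPolynomial.coeff (m + Finsupp.single k 1) g * zt_add_single m k

/-- The adjoint of `p_k` is a derivation sending `q_n` to `q_{n-k}`, so it lowers one index at a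
time by `k`. This matches how multiplication by `∑ y_i^k` acts on coefficients. -/
theorem form_X_mul_prod_qNat {ι : Type*} [Fintype ι] [DecidableEq ι] (k : ℕ+) (f : V)
    (β : ι →₀ ℕ) :
    form (f * MvPolynomial.X k) (∏ i, qNat (β i)) =
      ∑ i, if (k : ℕ) ≤ β i then
        form f (∏ j, qNat ((β - Finsupp.single i (k : ℕ)) j)) else 0 := by
  refine mul_left_cancel₀ (one_sub_t_pow_ne_zero k) ?_
  rw [form_X_mul, derivation_prod, map_sum, mul_sum, mul_sum]
  refine sum_congr rfl fun i _ => ?_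
  have h1 : ((k : ℕ) : F) * form f (MvPolynomial.pderiv k (qNat (β i)) *
        ∏ j ∈ univ.erase i, qNat (β j)) = (1 - t ^ (k : ℕ)) *
      form f ((if (k : ℕ) ≤ β i then qNat (β i - k) else 0) *
        ∏ j ∈ univ.erase i, qNat (β j)) := by
    rw [← smul_eq_mul, ← map_smul, ← smul_mul_assoc, pderiv_qNat, smul_mul_assoc, map_smul,
      smul_eq_mul]
  rw [h1]
  split_ifs with h
  · have h2 : ∏ j, qNat ((β - Finsupp.single i (k : ℕ)) j) =
        qNat (β i - k) * ∏ j ∈ univ.erase i, qNat (β j) := by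
      rw [← mul_prod_erase univ _ (mem_univ i)]
      refine congrArg₂ _ (by simp) (prod_congr rfl fun j hj => ?_)
      simp [(ne_of_mem_erase hj).symm]
    rw [h2]
  · rw [zero_mul, map_zero]

/-- The specialization of a symmetric function at the variables `y i`, `i ∈ S`. -/
def ev {ι R : Type*} [CommRing R] [Algebra F R] (y : ι → R) (S : Finset ι) : V →ₐ[F] R :=
  MvPolynomial.aeval fun k : ℕ+ => ∑ i ∈ S, y i ^ (k : ℕ)

theorem map_ev {ι R R' : Type*} [CommRing R] [Algebra F R] [CommRing R'] [Algebra F R']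
    (φ : R →ₐ[F] R') (y : ι → R) (S : Finset ι) (f : V) :
    φ (ev y S f) = ev (fun i => φ (y i)) S f := by
  have h : φ.comp (ev y S) = ev (fun i => φ (y i)) S := by
    ext k
    simp [ev]
  exact congrArg (fun ψ : V →ₐ[F] R' => ψ f) h

theorem qNat_zero_index : qNat 0 = 1 := by
  unfold qNat
  rw [Fintype.sum_eq_single default (fun x hx => absurd (Subsingleton.elim _ _) hx)]
  have h : mult (default : Nat.Partition 0) = 0 := by
    simp [mult]
  simp [pProd_eq_monomial, h, zt]

theorem coeff_zero_prod_qNat {ι : Type*} [Fintype ι] (β : ι →₀ ℕ) :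
    MvPolynomial.coeff 0 (∏ i, qNat (β i)) = if β = 0 then 1 else 0 := by
  have h : ∀ f : V, MvPolynomial.coeff 0 f = MvPolynomial.constantCoeff f := fun f => rfl
  rw [h, map_prod]
  simp only [← h, coeff_qNat]
  have hw : wt 0 = 0 := by simp [wt]
  have hz : zt 0 = 1 := by simp [zt]
  simp only [hw, hz, inv_one]
  split_ifs with h0
  · subst h0; simp
  · obtain ⟨i, hi⟩ : ∃ i, β i ≠ 0 := by
      by_contra hcon
      push Not at hcon
      exact h0 (Finsupp.ext hcon)
    exact prod_eq_zero (mem_univ i) (if_neg (Ne.symm hi))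

/-- Pairing with `q_β` extracts the coefficient of `y ^ β`. -/
theorem form_prod_qNat {ι : Type*} [Fintype ι] [DecidableEq ι] (f : V) (β : ι →₀ ℕ) :
    form f (∏ i, qNat (β i)) =
      MvPolynomial.coeff β (ev (MvPolynomial.X : ι → MvPolynomial ι F) univ f) := by
  induction f using MvPolynomial.induction_on generalizing β with
  | C a =>
    have hc : (MvPolynomial.C a : V) = a • MvPolynomial.monomial 0 1 := by
      rw [MvPolynomial.smul_monomial, smul_eq_mul, mul_one]; rfl
    have hev : ev (MvPolynomial.X : ι → MvPolynomial ι F) univ (MvPolynomial.C a) =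
        MvPolynomial.C a := by
      simp [ev, MvPolynomial.algebraMap_eq]
    rw [hev, MvPolynomial.coeff_C, hc, map_smul, LinearMap.smul_apply, form_monomial_left,
      coeff_zero_prod_qNat]
    have hz : zt 0 = 1 := by simp [zt]
    simp [hz, eq_comm]
  | add f g hf hg => rw [map_add, LinearMap.add_apply, map_add, MvPolynomial.coeff_add, hf, hg]
  | mul_X f k ih =>
    have hX : ev (MvPolynomial.X : ι → MvPolynomial ι F) univ (MvPolynomial.X k) =
        ∑ i, MvPolynomial.monomial (Finsupp.single i (k : ℕ)) 1 := by
      simp [ev, MvPolynomial.X_pow_eq_monomial]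
    -- Both sides obey the same recursion: one term for each `y_i^k` dividing `y^β`.
    rw [form_X_mul_prod_qNat, map_mul, hX, mul_sum, MvPolynomial.coeff_sum]
    refine sum_congr rfl fun i _ => ?_
    rw [MvPolynomial.coeff_mul_monomial', mul_one, ih]
    simp only [Finsupp.single_le_iff]

/-! ### Specializations of `q_n` at finitely many variables -/

theorem coeff_X_mul_pderiv {σ R : Type*} [CommSemiring R] (i : σ) (f : MvPolynomial σ R)
    (m : σ →₀ ℕ) :
    MvPolynomial.coeff m (MvPolynomial.X i * MvPolynomial.pderiv i f) =
      m i * MvPolynomial.coeff m f := by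
  classical
  rw [MvPolynomial.coeff_X_mul']
  split_ifs with h
  · have h1 : 1 ≤ m i := Nat.one_le_iff_ne_zero.mpr (Finsupp.mem_support_iff.mp h)
    have h2 : m - Finsupp.single i 1 + Finsupp.single i 1 = m :=
      tsub_add_cancel_of_le (Finsupp.single_le_iff.mpr h1)
    rw [MvPolynomial.coeff_pderiv, h2, mul_comm]
    congr 1
    rw [Finsupp.tsub_apply, Finsupp.single_eq_same]
    exact_mod_cast congrArg (Nat.cast (R := R)) (Nat.sub_add_cancel h1)
  · rw [Finsupp.notMem_support_iff.mp h]; simp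

theorem wt_eq_sum_range (m : ℕ+ →₀ ℕ) :
    ∑ i ∈ range (wt m + 1), i * m i.toPNat' = wt m := by
  classical
  have h1 : wt m = ∑ i ∈ m.support.map ⟨fun i : ℕ+ => (i : ℕ), PNat.coe_injective⟩,
      i * m i.toPNat' := by
    rw [sum_map]
    simp [wt, Finsupp.sum, mul_comm]
  conv_rhs => rw [h1]
  symm
  refine sum_subset ?_ ?_
  · intro i hi
    obtain ⟨k, hk, rfl⟩ := Finset.mem_map.mp hi
    have h2 : m k * (k : ℕ) ≤ wt m :=
      single_le_sum (f := fun i : ℕ+ => m i * (i : ℕ)) (fun _ _ => Nat.zero_le _) hk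
    have h3 : 1 ≤ m k := Nat.one_le_iff_ne_zero.mpr (Finsupp.mem_support_iff.mp hk)
    rw [mem_range]
    simp only [Function.Embedding.coeFn_mk]
    nlinarith
  · intro i _ hi
    rcases Nat.eq_zero_or_pos i with rfl | hpos
    · simp
    · have : m i.toPNat' = 0 := by
        by_contra hne
        refine hi (Finset.mem_map.mpr ⟨i.toPNat', Finsupp.mem_support_iff.mpr hne, ?_⟩)
        simp [hpos]
      rw [this, mul_zero]

/-- The Euler operator `∑ i p_i ∂/∂p_i` acts by `n` in weight `n`, and `pderiv_qNat` evaluates each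
derivative. -/
theorem newton_qNat (n : ℕ) :
    (n : F) • qNat n =
      ∑ ij ∈ antidiagonal n, (1 - t ^ ij.1) • (p ij.1 * qNat ij.2) := by
  rw [Nat.sum_antidiagonal_eq_sum_range_succ_mk]
  have h1 : ∀ i ∈ range n.succ, (1 - t ^ i) • (p i * qNat (n - i)) =
      (i : F) • (MvPolynomial.X i.toPNat' * MvPolynomial.pderiv i.toPNat' (qNat n)) := by
    intro i hi
    -- The meaningless `p 0` is harmless, since its coefficient `1 - t^0` is zero.
    rcases Nat.eq_zero_or_pos i with rfl | hpos
    · simp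
    · have h := pderiv_qNat n i.toPNat'
      have hc : (i.toPNat' : ℕ) = i := by simp [hpos]
      rw [hc, if_pos (Nat.lt_succ_iff.mp (mem_range.mp hi))] at h
      rw [← mul_smul_comm, ← mul_smul_comm, h]
      rfl
  rw [sum_congr rfl h1]
  ext m
  simp only [MvPolynomial.coeff_sum, MvPolynomial.coeff_smul, coeff_X_mul_pderiv, coeff_qNat,
    smul_eq_mul]
  split_ifs with h
  · subst h
    simp only [← mul_assoc, ← sum_mul]
    congr 1
    exact_mod_cast congrArg (Nat.cast (R := F)) (wt_eq_sum_range m).symm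
  · simp

/-! ### Generating series and partial fractions -/

section Specialization

variable {ι K : Type*} [Field K]

/-- The geometric series `1 / (1 - a X)`. -/
def geom (a : K) : PowerSeries K := PowerSeries.mk fun n => a ^ n

theorem one_sub_mul_geom (a : K) : (1 - PowerSeries.C a * PowerSeries.X) * geom a = 1 := by
  ext n
  rw [sub_mul, one_mul, map_sub, mul_assoc, PowerSeries.coeff_C_mul]
  cases n with
  | zero => simp [geom]
  | succ n => simp [geom, PowerSeries.coeff_succ_X_mul, PowerSeries.coeff_one, pow_succ']

theorem derivative_geom (a : K) :
    PowerSeries.derivative K (geom a) = PowerSeries.C a * geom a ^ 2 := by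
  have h := congrArg (PowerSeries.derivative K) (one_sub_mul_geom a)
  rw [Derivation.leibniz, map_sub, Derivation.leibniz] at h
  simp only [PowerSeries.derivative_X, PowerSeries.derivative_C, Derivation.map_one_eq_zero,
    smul_eq_mul, mul_zero, mul_one, add_zero, zero_sub] at h
  linear_combination geom a * h - PowerSeries.derivative K (geom a) * one_sub_mul_geom a

/-- Uniqueness for a first-order equation: as `P` has no constant term, coefficient `n` of `D`,
times `n`, is determined by earlier coefficients. -/
theorem eq_zero_of_X_mul_derivative_eq [CharZero K] (P D : PowerSeries K)
    (hP : PowerSeries.coeff 0 P = 0) (hD : PowerSeries.coeff 0 D = 0)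
    (h : PowerSeries.X * PowerSeries.derivative K D = P * D) : D = 0 := by
  ext n
  rw [map_zero]
  induction n using Nat.strong_induction_on with
  | _ n ih =>
    cases n with
    | zero => exact hD
    | succ n =>
      have h1 := congrArg (PowerSeries.coeff (n + 1)) h
      rw [PowerSeries.coeff_succ_X_mul, PowerSeries.coeff_derivative, PowerSeries.coeff_mul,
        sum_eq_zero] at h1
      · exact (mul_eq_zero.mp h1).resolve_right (by exact_mod_cast n.succ_ne_zero)
      · rintro ⟨i, j⟩ hij
        rw [Finset.HasAntidiagonal.mem_antidiagonal] at hij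
        rcases Nat.eq_zero_or_pos i with rfl | hi
        · rw [hP, zero_mul]
        · rw [ih j (by simp only at hij; omega), mul_zero]

variable [DecidableEq ι] [Algebra F K]

/-- The series `(1 - t a X) / (1 - a X)`. -/
def hfac (a : K) : PowerSeries K :=
  (1 - PowerSeries.C (algebraMap F K t * a) * PowerSeries.X) * geom a

/-- The series `∏_{i ∈ S} (1 - t y_i X) / (1 - y_i X)`. -/
def hser (y : ι → K) (S : Finset ι) : PowerSeries K := ∏ i ∈ S, hfac (y i)

theorem derivative_hfac (a : K) :
    PowerSeries.X * PowerSeries.derivative K (hfac a) =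
      (geom a - geom (algebraMap F K t * a)) * hfac a := by
  have h1 := one_sub_mul_geom a
  have h2 := one_sub_mul_geom (algebraMap F K t * a)
  unfold hfac
  rw [Derivation.leibniz, map_sub, Derivation.leibniz, derivative_geom]
  simp only [PowerSeries.derivative_X, PowerSeries.derivative_C, Derivation.map_one_eq_zero,
    smul_eq_mul, mul_zero, mul_one, add_zero, zero_sub]
  linear_combination (geom a) * h2 - (1 - PowerSeries.C (algebraMap F K t * a) * PowerSeries.X) *
    geom a * h1

theorem derivative_hser (y : ι → K) (S : Finset ι) :
    PowerSeries.X * PowerSeries.derivative K (hser y S) =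
      (∑ i ∈ S, (geom (y i) - geom (algebraMap F K t * y i))) * hser y S := by
  unfold hser
  rw [derivation_prod, mul_sum, sum_mul]
  refine sum_congr rfl fun i hi => ?_
  rw [← mul_assoc, derivative_hfac, mul_assoc, mul_prod_erase S (fun i => hfac (y i)) hi]

/-- Both series have constant term `1` and solve `X G' = P G`, where `P` has coefficients `(1 - t^n)
∑ y_j^n`; Newton's identity gives this for the `q_n`. -/
theorem ev_qNat (y : ι → K) (S : Finset ι) (n : ℕ) :
    ev y S (qNat n) = PowerSeries.coeff n (hser y S) := by
  have : CharZero K := charZero_of_injective_algebraMap (algebraMap F K).injective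
  set P : PowerSeries K := ∑ i ∈ S, (geom (y i) - geom (algebraMap F K t * y i)) with hP
  set G : PowerSeries K := PowerSeries.mk fun n => ev y S (qNat n) with hG
  have hPc : ∀ i, PowerSeries.coeff i P = (1 - algebraMap F K t ^ i) * ∑ j ∈ S, y j ^ i := by
    intro i
    rw [hP, map_sum, mul_sum]
    refine sum_congr rfl fun j _ => ?_
    simp [geom, mul_pow, sub_mul]
  have hGd : PowerSeries.X * PowerSeries.derivative K G = P * G := by
    ext n
    have h1 := congrArg (ev y S) (newton_qNat n)
    rw [map_smul, map_sum, Algebra.smul_def, map_natCast] at h1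
    have h2 : PowerSeries.coeff n (PowerSeries.X * PowerSeries.derivative K G) =
        n * ev y S (qNat n) := by
      cases n with
      | zero => simp
      | succ n =>
        rw [PowerSeries.coeff_succ_X_mul, PowerSeries.coeff_derivative, hG, PowerSeries.coeff_mk]
        push_cast
        ring
    rw [h2, h1, PowerSeries.coeff_mul]
    refine sum_congr rfl fun ij _ => ?_
    rw [hPc, hG, PowerSeries.coeff_mk, map_smul, map_mul, Algebra.smul_def, map_sub, map_one,
      map_pow, ← mul_assoc]
    rcases Nat.eq_zero_or_pos ij.1 with h0 | h0
    · simp [h0]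
    · simp [ev, p, h0]
  have hD : G - hser y S = 0 := by
    refine eq_zero_of_X_mul_derivative_eq P _ (by simp [hPc]) ?_ ?_
    · rw [map_sub, hG, PowerSeries.coeff_mk, qNat_zero_index, map_one, hser, sub_eq_zero,
        PowerSeries.coeff_zero_eq_constantCoeff_apply, map_prod]
      symm
      refine prod_eq_one fun i _ => ?_
      have hg : PowerSeries.constantCoeff (geom (y i)) = 1 := by
        rw [← PowerSeries.coeff_zero_eq_constantCoeff_apply, geom, PowerSeries.coeff_mk, pow_zero]
      simp [hfac, hg]
    · rw [map_sub, mul_sub, mul_sub, hGd, derivative_hser]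
  rw [← sub_eq_zero.mp hD, hG, PowerSeries.coeff_mk]

/-- Removing `y_i` multiplies by `(1 - y_i X)/(1 - t y_i X)`, the raising-operator series evaluated
at `R = y_i X`. -/
theorem hser_erase (y : ι → K) {S : Finset ι} {i : ι} (hi : i ∈ S) :
    hser y (S.erase i) = PowerSeries.mk (fun b => algebraMap F K (raiseCoeff b) * y i ^ b) *
      hser y S := by
  set D : PowerSeries F :=
    (1 - PowerSeries.X) * (1 - PowerSeries.C t * PowerSeries.X)⁻¹ with hD
  have h1 : (1 - PowerSeries.C t * PowerSeries.X) * D = 1 - PowerSeries.X := by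
    rw [hD, mul_left_comm, PowerSeries.mul_inv_cancel _ (by simp), mul_one]
  have h2 : PowerSeries.mk (fun b => algebraMap F K (raiseCoeff b) * y i ^ b) =
      PowerSeries.rescale (y i) (PowerSeries.map (algebraMap F K) D) := by
    ext b
    rw [PowerSeries.coeff_mk, PowerSeries.coeff_rescale, PowerSeries.coeff_map, mul_comm]
    rfl
  have h6 : ∀ a c : K, PowerSeries.rescale a (PowerSeries.C c) = PowerSeries.C c := by
    intro a c
    ext n
    rw [PowerSeries.coeff_rescale, PowerSeries.coeff_C]
    split_ifs with h <;> simp [h]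
  have h3 := congrArg (fun f => PowerSeries.rescale (y i) (PowerSeries.map (algebraMap F K) f)) h1
  simp only [map_mul, map_sub, map_one, PowerSeries.map_C, PowerSeries.map_X,
    PowerSeries.rescale_X, h6, ← h2] at h3
  have h4 := one_sub_mul_geom (y i)
  have h5 : hser y S = hfac (y i) * hser y (S.erase i) :=
    (mul_prod_erase S (fun i => hfac (y i)) hi).symm
  rw [h5, hfac, map_mul]
  linear_combination -(geom (y i) * hser y (S.erase i)) * h3 - hser y (S.erase i) * h4

theorem ev_erase_q (y : ι → K) {S : Finset ι} {i : ι} (hi : i ∈ S) (n : ℤ) (N : ℕ)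
    (hN : n < N) :
    ev y (S.erase i) (q n) = ∑ b ∈ range N,
      algebraMap F K (raiseCoeff b) * y i ^ b * ev y S (q (n - b)) := by
  rcases lt_or_ge n 0 with hn | hn
  · rw [q, if_pos hn, map_zero]
    symm
    refine sum_eq_zero fun b _ => ?_
    rw [q, if_pos (by omega), map_zero, mul_zero]
  · lift n to ℕ using hn
    rw [q, if_neg (by omega), Int.toNat_natCast, ev_qNat, hser_erase y hi, PowerSeries.coeff_mul,
      Nat.sum_antidiagonal_eq_sum_range_succ_mk]
    have hsub : range n.succ ⊆ range N := range_subset_range.mpr (by omega)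
    rw [← sum_subset hsub]
    · refine sum_congr rfl fun b hb => ?_
      rw [mem_range] at hb
      rw [PowerSeries.coeff_mk, q, if_neg (by omega), ev_qNat]
      congr 3
      omega
    · intro b _ hb
      rw [mem_range] at hb
      rw [q, if_pos (by omega), map_zero, mul_zero]

/-- The coefficients `(1 - t) ∏_{j ≠ i} (y_i - t y_j) / (y_i - y_j)` of the partial fraction
expansion of `∏_{i ∈ S} (1 - t y_i X) / (1 - y_i X)`. -/
def pfCoeff (y : ι → K) (S : Finset ι) (i : ι) : K :=
  (1 - algebraMap F K t) * ∏ j ∈ S.erase i, (y i - algebraMap F K t * y j) / (y i - y j)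

theorem exists_partialFraction (y : ι → K) (hy : Function.Injective y) (hy0 : ∀ i, y i ≠ 0)
    (S : Finset ι) : ∃ c : K,
    ∏ j ∈ S, (1 - Polynomial.C (algebraMap F K t * y j) * Polynomial.X) =
      Polynomial.C c * ∏ j ∈ S, (1 - Polynomial.C (y j) * Polynomial.X) +
      ∑ i ∈ S, Polynomial.C (pfCoeff y S i) *
        ∏ j ∈ S.erase i, (1 - Polynomial.C (y j) * Polynomial.X) := by
  classical
  have hlin : ∀ a : K, (1 - Polynomial.C a * Polynomial.X).natDegree ≤ 1 := fun a => by
    compute_degree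
  have hdeg : ∀ (T : Finset ι) (z : ι → K),
      (∏ j ∈ T, (1 - Polynomial.C (z j) * Polynomial.X)).natDegree ≤ #T := fun T z => by
    refine (Polynomial.natDegree_prod_le _ _).trans ?_
    simpa using sum_le_card_nsmul T _ 1 fun j _ => hlin (z j)
  set R₀ := ∏ j ∈ S, (1 - Polynomial.C (algebraMap F K t * y j) * Polynomial.X) -
    ∑ i ∈ S, Polynomial.C (pfCoeff y S i) *
        ∏ j ∈ S.erase i, (1 - Polynomial.C (y j) * Polynomial.X) with hR₀
  have hd₀ : R₀.natDegree ≤ #S := by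
    refine (Polynomial.natDegree_sub_le _ _).trans (max_le (hdeg S _) ?_)
    refine Polynomial.natDegree_sum_le_of_forall_le _ _ fun i _ => ?_
    exact (Polynomial.natDegree_C_mul_le _ _).trans ((hdeg _ _).trans (card_erase_le))
  -- The degree is at most `|S|`, but there are `|S| + 1` zeros: the points `y_i⁻¹`, and `0` by the
  -- choice of constant.
  have key : R₀ - Polynomial.C (R₀.eval 0) *
      ∏ j ∈ S, (1 - Polynomial.C (y j) * Polynomial.X) = 0 := by
    refine Polynomial.eq_zero_of_natDegree_lt_card_of_eval_eq_zero' _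
      (insert 0 (S.image fun i => (y i)⁻¹)) ?_ ?_
    · intro x hx
      rcases mem_insert.mp hx with rfl | hx
      · simp [Polynomial.eval_prod]
      · obtain ⟨i, hi, rfl⟩ := mem_image.mp hx
        have hE : (∏ j ∈ S, (1 - Polynomial.C (y j) * Polynomial.X)).eval (y i)⁻¹ = 0 := by
          rw [Polynomial.eval_prod]
          exact prod_eq_zero hi (by simp [hy0 i])
        rw [Polynomial.eval_sub, Polynomial.eval_mul, hE, mul_zero, sub_zero, hR₀,
          Polynomial.eval_sub, Polynomial.eval_finsetSum, sum_eq_single i, sub_eq_zero]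
        · simp only [Polynomial.eval_prod, Polynomial.eval_mul, Polynomial.eval_C,
            Polynomial.eval_sub, Polynomial.eval_one, Polynomial.eval_X]
          rw [← mul_prod_erase S _ hi, pfCoeff, mul_assoc (1 - algebraMap F K t), ← prod_mul_distrib,
            mul_assoc (algebraMap F K t) (y i), mul_inv_cancel₀ (hy0 i), mul_one]
          refine congrArg _ (prod_congr rfl fun j hj => ?_)
          have h1 : y i - y j ≠ 0 :=
            sub_ne_zero.mpr fun h => ne_of_mem_erase hj (hy h).symm
          have h2 := hy0 i
          field_simp
        · intro j _ hji
          rw [Polynomial.eval_mul, Polynomial.eval_prod,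
            prod_eq_zero (mem_erase.mpr ⟨hji.symm, hi⟩) (by simp [hy0 i]), mul_zero]
        · exact fun h => absurd hi h
    · rw [card_insert_of_notMem, card_image_of_injective _ fun a b h => hy (inv_injective h)]
      · refine Nat.lt_succ_of_le ((Polynomial.natDegree_sub_le _ _).trans (max_le hd₀ ?_))
        exact (Polynomial.natDegree_C_mul_le _ _).trans (hdeg S y)
      · simp [hy0]
  exact ⟨R₀.eval 0, by linear_combination key⟩

/-- The constant `c` of the partial fraction expansion affects only the coefficient of `X^0`, hence
the condition `0 < n`. -/
theorem ev_q_eq_sum (y : ι → K) (hy : Function.Injective y) (hy0 : ∀ i, y i ≠ 0)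
    (S : Finset ι) (n : ℕ) (hn : 0 < n) :
    ev y S (q n) = ∑ i ∈ S, pfCoeff y S i * y i ^ n := by
  obtain ⟨c, hc⟩ := exists_partialFraction y hy hy0 S
  have h1 := congrArg (fun f : Polynomial K => (f : PowerSeries K) * ∏ i ∈ S, geom (y i)) hc
  have hprod : ∀ (T : Finset ι) (z : ι → K),
      ((∏ j ∈ T, (1 - Polynomial.C (z j) * Polynomial.X) : Polynomial K) : PowerSeries K) =
      ∏ j ∈ T, (1 - PowerSeries.C (z j) * PowerSeries.X) := by
    intro T z
    rw [← Polynomial.coeToPowerSeries.ringHom_apply, map_prod]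
    simp
  have h2 : hser y S = PowerSeries.C c + ∑ i ∈ S, PowerSeries.C (pfCoeff y S i) * geom (y i) := by
    unfold hser hfac
    rw [prod_mul_distrib, ← hprod S fun i => algebraMap F K t * y i, h1, Polynomial.coe_add,
      Polynomial.coe_mul, hprod, add_mul, mul_assoc, ← prod_mul_distrib,
      prod_congr rfl fun i _ => one_sub_mul_geom (y i), prod_const_one, mul_one,
      Polynomial.coe_C, ← Polynomial.coeToPowerSeries.ringHom_apply, map_sum, sum_mul]
    refine congrArg _ (sum_congr rfl fun i hi => ?_)
    rw [Polynomial.coeToPowerSeries.ringHom_apply, Polynomial.coe_mul, hprod, Polynomial.coe_C,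
      mul_assoc, ← mul_prod_erase S _ hi, mul_left_comm (∏ j ∈ S.erase i, _),
      ← prod_mul_distrib, prod_congr rfl fun i _ => one_sub_mul_geom (y i), prod_const_one,
      mul_one]
  rw [q, if_neg (by omega), Int.toNat_natCast, ev_qNat, h2, map_add, map_sum,
    PowerSeries.coeff_C, if_neg hn.ne', zero_add]
  simp [geom]

end Specialization

/-! ### Specializations of `∏ (1 - R_{ij}) / (1 - t R_{ij}) q_α` -/

/-- Pairs of positions in a sequence of length `l + 1`, split according to whether the first
position is `0`. -/
def pairsSuccEquiv (l : ℕ) : Fin l ⊕ Pairs l ≃ Pairs (l + 1) :=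
  Equiv.ofBijective
    (Sum.elim (fun k => ⟨(0, k.succ), k.succ_pos⟩)
      fun ij => ⟨(ij.1.1.succ, ij.1.2.succ), Fin.succ_lt_succ_iff.mpr ij.2⟩) <| by
    constructor
    · rintro (k | ⟨⟨i, j⟩, h⟩) (k' | ⟨⟨i', j'⟩, h'⟩) heq
      · simpa using heq
      · simp [(Fin.succ_ne_zero _).symm] at heq
      · simp at heq
      · simpa using heq
    · rintro ⟨⟨i, j⟩, h⟩
      obtain ⟨j, rfl⟩ := Fin.exists_succ_eq.mpr (Fin.ne_zero_of_lt h)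
      rcases Fin.eq_zero_or_eq_succ i with rfl | ⟨i, rfl⟩
      · exact ⟨Sum.inl j, rfl⟩
      · exact ⟨Sum.inr ⟨(i, j), Fin.succ_lt_succ_iff.mp h⟩, rfl⟩

theorem pairsSuccEquiv_inl {l : ℕ} (k : Fin l) :
    (pairsSuccEquiv l (Sum.inl k)).1 = (0, k.succ) := rfl

theorem pairsSuccEquiv_inr {l : ℕ} (ij : Pairs l) :
    (pairsSuccEquiv l (Sum.inr ij)).1 = (ij.1.1.succ, ij.1.2.succ) := rfl

/-- Exponents of raising operators on sequences of length `l + 1`, split according to whether the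
first position is `0`. -/
def exponentsEquiv (l : ℕ) : (Pairs l → ℕ) × (Fin l → ℕ) ≃ (Pairs (l + 1) → ℕ) :=
  (Equiv.prodComm _ _).trans ((Equiv.sumArrowEquivProdArrow _ _ _).symm.trans
    (Equiv.arrowCongr (pairsSuccEquiv l) (Equiv.refl ℕ)))

theorem exponentsEquiv_inl {l : ℕ} (a : Pairs l → ℕ) (b : Fin l → ℕ) (k : Fin l) :
    exponentsEquiv l (a, b) (pairsSuccEquiv l (Sum.inl k)) = b k := by
  simp [exponentsEquiv, Equiv.arrowCongr]

theorem exponentsEquiv_inr {l : ℕ} (a : Pairs l → ℕ) (b : Fin l → ℕ) (ij : Pairs l) :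
    exponentsEquiv l (a, b) (pairsSuccEquiv l (Sum.inr ij)) = a ij := by
  simp [exponentsEquiv, Equiv.arrowCongr]

theorem raise_apply {l : ℕ} (α : Fin l → ℤ) (a : Pairs l → ℕ) (k : Fin l) :
    raise α a k = α k + ∑ ij : Pairs l,
      (a ij : ℤ) * ((if k = ij.1.1 then 1 else 0) - if k = ij.1.2 then 1 else 0) := by
  simp [raise, Finset.sum_apply, Pi.single_apply]

theorem raise_cons_zero {l : ℕ} (r : ℤ) (α : Fin l → ℤ) (a : Pairs l → ℕ) (b : Fin l → ℕ) :
    raise (Fin.cons r α : Fin (l + 1) → ℤ) (exponentsEquiv l (a, b)) 0 = r + ∑ k, (b k : ℤ) := by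
  rw [raise_apply, ← (pairsSuccEquiv l).sum_comp, Fintype.sum_sum_type]
  simp only [exponentsEquiv_inl, exponentsEquiv_inr]
  simp [pairsSuccEquiv_inl, pairsSuccEquiv_inr, (Fin.succ_ne_zero _).symm]

theorem raise_cons_succ {l : ℕ} (r : ℤ) (α : Fin l → ℤ) (a : Pairs l → ℕ) (b : Fin l → ℕ)
    (k : Fin l) :
    raise (Fin.cons r α : Fin (l + 1) → ℤ) (exponentsEquiv l (a, b)) k.succ =
      raise α a k - b k := by
  rw [raise_apply, raise_apply, ← (pairsSuccEquiv l).sum_comp, Fintype.sum_sum_type]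
  simp only [exponentsEquiv_inl, exponentsEquiv_inr]
  simp [pairsSuccEquiv_inl, pairsSuccEquiv_inr]
  ring

theorem prod_raiseCoeff_exponentsEquiv {l : ℕ} (a : Pairs l → ℕ) (b : Fin l → ℕ) :
    ∏ ij, raiseCoeff (exponentsEquiv l (a, b) ij) =
      (∏ k, raiseCoeff (b k)) * ∏ ij, raiseCoeff (a ij) := by
  rw [← (pairsSuccEquiv l).prod_comp, Fintype.prod_sum_type]
  simp only [exponentsEquiv_inl, exponentsEquiv_inr]

section Specialization

variable {ι K : Type*} [Field K] [Algebra F K]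

theorem ev_smul_prod {κ : Type*} [Fintype κ] (y : ι → K) (S : Finset ι) (c : F) (f : κ → V) :
    ev y S (c • ∏ k, f k) = algebraMap F K c * ∏ k, ev y S (f k) := by
  rw [map_smul, Algebra.smul_def, map_prod]

theorem ev_Qseq (y : ι → K) (S : Finset ι) {l : ℕ} (α : Fin l → ℤ) :
    ev y S (Qseq α) = ∑ᶠ a : Pairs l → ℕ,
      algebraMap F K (∏ ij, raiseCoeff (a ij)) * ∏ k, ev y S (q (raise α a k)) := by
  unfold Qseq
  rw [map_finsum _ (raisingTerm_finite α)]
  simp only [ev_smul_prod]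

theorem ev_Qseq_nil (y : ι → K) (S : Finset ι) (α : Fin 0 → ℤ) : ev y S (Qseq α) = 1 := by
  rw [ev_Qseq, finsum_unique]
  simp

theorem evTerm_finite (y : ι → K) (S : Finset ι) {l : ℕ} (α : Fin l → ℤ) :
    (Function.support fun a : Pairs l → ℕ =>
      algebraMap F K (∏ ij, raiseCoeff (a ij)) * ∏ k, ev y S (q (raise α a k))).Finite := by
  refine (raisingTerm_finite α).subset fun a ha h => ha ?_
  have h1 := congrArg (ev y S) h
  simpa only [ev_smul_prod, map_zero] using h1

theorem prod_shift_support (y : ι → K) (S : Finset ι) {l : ℕ} (γ : Fin l → ℤ) (N : ℕ)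
    (hN : ∀ k, γ k < N) (c : (Fin l → ℕ) → K) :
    (Function.support fun b : Fin l → ℕ => c b * ∏ k, ev y S (q (γ k - b k))) ⊆
      (Fintype.piFinset fun _ : Fin l => range N : Finset (Fin l → ℕ)) := by
  intro b hb
  rw [mem_coe, Fintype.mem_piFinset]
  intro k
  by_contra hk
  refine hb ?_
  have h1 : q (γ k - b k) = 0 := by
    rw [mem_range] at hk
    have := hN k
    rw [q, if_pos (by omega)]
  show c b * _ = 0
  rw [prod_eq_zero (mem_univ k) (by rw [h1, map_zero]), mul_zero]

theorem exists_bound {l : ℕ} (γ : Fin l → ℤ) : ∃ N : ℕ, ∀ k, γ k < N := by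
  refine ⟨∑ k, (γ k).toNat + 1, fun k => ?_⟩
  have := single_le_sum (f := fun k => (γ k).toNat) (fun _ _ => Nat.zero_le _) (mem_univ k)
  omega

variable [DecidableEq ι]

theorem prod_ev_erase_q (y : ι → K) {S : Finset ι} {i : ι} (hi : i ∈ S) {l : ℕ}
    (γ : Fin l → ℤ) :
    ∏ k, ev y (S.erase i) (q (γ k)) = ∑ᶠ b : Fin l → ℕ,
      (algebraMap F K (∏ k, raiseCoeff (b k)) * y i ^ ∑ k, b k) *
        ∏ k, ev y S (q (γ k - b k)) := by
  obtain ⟨N, hN⟩ := exists_bound γ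
  rw [finsum_eq_sum_of_support_subset _ (prod_shift_support y S γ N hN _),
    prod_congr rfl fun k _ => ev_erase_q y hi (γ k) N (hN k), prod_univ_sum]
  refine sum_congr rfl fun b _ => ?_
  rw [prod_mul_distrib, prod_mul_distrib, map_prod, prod_pow_eq_pow_sum]

/-- With `b_k` the exponents of the operators involving the first position, its index becomes `r + ∑
b_k > 0`, so partial fractions apply. The sum over `b` of the terms with `y_i^{∑ b_k}` then deletes
`y_i` from the remaining factors. -/
theorem ev_Qseq_cons (y : ι → K) (hy : Function.Injective y) (hy0 : ∀ i, y i ≠ 0)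
    (S : Finset ι) {l : ℕ} (r : ℕ) (hr : 0 < r) (α : Fin l → ℤ) :
    ev y S (Qseq (Fin.cons (r : ℤ) α : Fin (l + 1) → ℤ)) =
      ∑ i ∈ S, pfCoeff y S i * y i ^ r * ev y (S.erase i) (Qseq α) := by
  rw [ev_Qseq, ← finsum_comp_equiv (exponentsEquiv l), finsum_curry]
  swap
  · exact (evTerm_finite y S _).preimage (exponentsEquiv l).injective.injOn
  have hterm : ∀ (a : Pairs l → ℕ) (b : Fin l → ℕ),
      algebraMap F K (∏ ij, raiseCoeff (exponentsEquiv l (a, b) ij)) *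
        ∏ k, ev y S (q (raise (Fin.cons (r : ℤ) α : Fin (l + 1) → ℤ)
          (exponentsEquiv l (a, b)) k)) =
      ∑ i ∈ S, (pfCoeff y S i * y i ^ r * algebraMap F K (∏ ij, raiseCoeff (a ij))) *
        ((algebraMap F K (∏ k, raiseCoeff (b k)) * y i ^ ∑ k, b k) *
          ∏ k, ev y S (q (raise α a k - b k))) := by
    intro a b
    have h1 : (r : ℤ) + ∑ k, (b k : ℤ) = ((r + ∑ k, b k : ℕ) : ℤ) := by push_cast; rfl
    rw [Fin.prod_univ_succ, raise_cons_zero, prod_raiseCoeff_exponentsEquiv, h1,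
      ev_q_eq_sum y hy hy0 S _ (by omega), sum_mul, mul_sum]
    simp only [raise_cons_succ]
    refine sum_congr rfl fun i _ => ?_
    rw [map_mul, pow_add]
    ring
  simp only [hterm]
  have hinner : ∀ a : Pairs l → ℕ,
      (∑ᶠ b : Fin l → ℕ, ∑ i ∈ S,
        (pfCoeff y S i * y i ^ r * algebraMap F K (∏ ij, raiseCoeff (a ij))) *
        ((algebraMap F K (∏ k, raiseCoeff (b k)) * y i ^ ∑ k, b k) *
          ∏ k, ev y S (q (raise α a k - b k)))) =
      ∑ i ∈ S, pfCoeff y S i * y i ^ r * (algebraMap F K (∏ ij, raiseCoeff (a ij)) *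
        ∏ k, ev y (S.erase i) (q (raise α a k))) := by
    intro a
    obtain ⟨N, hN⟩ := exists_bound (raise α a)
    have hfin : ∀ c : (Fin l → ℕ) → K, (Function.support fun b : Fin l → ℕ =>
        c b * ∏ k, ev y S (q (raise α a k - b k))).Finite := fun c =>
      (Finset.finite_toSet _).subset (prod_shift_support y S _ N hN c)
    rw [finsum_sum_comm]
    · refine sum_congr rfl fun i hi => ?_
      rw [← mul_finsum, prod_ev_erase_q y hi, mul_assoc]
    · intro i _
      simp only [← mul_assoc _ _ (∏ k, ev y S (q (raise α a k - _)))]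
      exact hfin _
  simp only [hinner]
  rw [finsum_sum_comm]
  · refine sum_congr rfl fun i _ => ?_
    rw [← mul_finsum, ev_Qseq]
  · intro i _
    refine (evTerm_finite y (S.erase i) α).subset fun a ha h => ha ?_
    simp only at h ⊢
    rw [h, mul_zero]

end Specialization

/-! ### Degree bounds -/

section Valuation

open WithZero

variable {ι K : Type*} [DecidableEq ι] [Field K] [Algebra F K]

/-- No cancellation occurs in `y_i - y_j`, so each denominator is at least as large as its
numerator. -/
theorem valuation_pfCoeff_le_one (v : Valuation K ℤᵐ⁰) (y : ι → K)
    (hF : ∀ c : F, v (algebraMap F K c) ≤ 1)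
    (hsub : ∀ i j, i ≠ j → v (y i - y j) = max (v (y i)) (v (y j))) (S : Finset ι) (i : ι) :
    v (pfCoeff y S i) ≤ 1 := by
  rw [pfCoeff, map_mul, map_prod]
  refine mul_le_one' (by simpa using hF (1 - t)) (Finset.prod_le_one' fun j hj => ?_)
  rw [map_div₀, hsub i j (ne_of_mem_erase hj).symm]
  refine div_le_one_of_le₀ ?_ zero_le
  refine (v.map_sub _ _).trans (max_le_max le_rfl ?_)
  rw [map_mul]
  exact mul_le_of_le_one_left' (hF t)

theorem sum_take_le_sum_take_cons (L : List ℕ) (r c : ℕ) (hL : ∀ x ∈ L, x ≤ r) :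
    (L.take c).sum ≤ ((r :: L).take c).sum := by
  cases c with
  | zero => simp
  | succ c =>
    rw [List.take_succ_cons, List.sum_cons, List.take_add_one, List.sum_append, add_comm]
    refine Nat.add_le_add_right ?_ _
    cases h : L[c]? with
    | none => simp
    | some x => simpa using hL x (List.mem_of_getElem? h)

theorem valuation_ev_Qseq_le (v : Valuation K ℤᵐ⁰) (y : ι → K) (hy : Function.Injective y)
    (hy0 : ∀ i, y i ≠ 0) (T : Finset ι) (hF : ∀ c : F, v (algebraMap F K c) ≤ 1)
    (hvy : ∀ i, v (y i) = exp (if i ∈ T then 1 else 0 : ℤ))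
    (hsub : ∀ i j, i ≠ j → v (y i - y j) = max (v (y i)) (v (y j)))
    (L : List ℕ) (hL : L.Pairwise (· ≥ ·)) (hpos : ∀ x ∈ L, 0 < x) (S : Finset ι) :
    v (ev y S (Qseq fun k : Fin L.length => (L.get k : ℤ))) ≤
      exp ((L.take #(S ∩ T)).sum : ℤ) := by
  induction L generalizing S with
  | nil =>
    have h := ev_Qseq_nil y S fun k : Fin ([] : List ℕ).length => (([] : List ℕ).get k : ℤ)
    rw [h]
    simp
  | cons r L ih =>
    have hcons : (fun k : Fin (r :: L).length => ((r :: L).get k : ℤ)) =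
        (Fin.cons (r : ℤ) (fun k : Fin L.length => (L.get k : ℤ)) : Fin (L.length + 1) → ℤ) := by
      funext k
      refine Fin.cases ?_ (fun k => ?_) k <;> simp
    rw [hcons, ev_Qseq_cons y hy hy0 S r (hpos r (by simp))]
    rw [List.pairwise_cons] at hL
    refine v.map_sum_le fun i hi => ?_
    have h1 := ih hL.2 (fun x hx => hpos x (by simp [hx])) (S.erase i)
    have h2 : v (y i) ^ r = exp ((if i ∈ T then (r : ℤ) else 0)) := by
      rw [hvy, ← exp_nsmul]
      split_ifs <;> simp
    rw [map_mul, map_mul, map_pow, h2, mul_assoc]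
    refine (mul_le_of_le_one_left' (valuation_pfCoeff_le_one v y hF hsub S i)).trans ?_
    refine (mul_le_mul_right h1 _).trans ?_
    rw [← exp_add, exp_le_exp]
    split_ifs with hiT
    · have hcard : #(S ∩ T) = #(S.erase i ∩ T) + 1 := by
        rw [erase_inter, card_erase_add_one (mem_inter.mpr ⟨hi, hiT⟩)]
      rw [hcard, List.take_succ_cons, List.sum_cons]
      push_cast
      rfl
    · have hcard : S.erase i ∩ T = S ∩ T := by
        rw [erase_inter, erase_eq_of_notMem fun h => hiT (mem_inter.mp h).2]
      rw [hcard, zero_add]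
      -- For `i ∉ T` the part `r` is lost; since it is the largest, the sum of the first parts
      -- cannot grow by losing it.
      exact_mod_cast sum_take_le_sum_take_cons L r _ hL.1

end Valuation

/-! ### Scaling a set of variables and the place at infinity -/

section Scaling

variable {σ 𝕜 : Type*} [DecidableEq σ] [Field 𝕜]

/-- The substitution multiplying the variables in `T` by a new variable. -/
def scaleVars (T : Finset σ) : MvPolynomial σ 𝕜 →+* Polynomial (MvPolynomial σ 𝕜) :=
  MvPolynomial.eval₂Hom (Polynomial.C.comp MvPolynomial.C) fun i =>
    Polynomial.C (MvPolynomial.X i) * if i ∈ T then Polynomial.X else 1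

theorem scaleVars_monomial [Fintype σ] (T : Finset σ) (m : σ →₀ ℕ) (c : 𝕜) :
    scaleVars T (MvPolynomial.monomial m c) =
      Polynomial.C (MvPolynomial.monomial m c) * Polynomial.X ^ ∑ i ∈ T, m i := by
  rw [scaleVars, MvPolynomial.coe_eval₂Hom, MvPolynomial.eval₂_monomial,
    Finsupp.prod_fintype _ _ (by simp), MvPolynomial.monomial_eq,
    Finsupp.prod_fintype _ _ (by simp), map_mul, map_prod]
  simp only [mul_pow, prod_mul_distrib, map_pow, RingHom.comp_apply, mul_assoc]
  congr 2
  rw [← prod_pow_eq_pow_sum, ← Finset.prod_subset (subset_univ T)]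
  · exact prod_congr rfl fun i hi => by rw [if_pos hi]
  · intro i _ hi
    rw [if_neg hi, one_pow]

/-- The monomial `y^β` is placed in degree `∑_{i ∈ T} β_i` of the new variable, so a degree bound
there kills coefficients of `P`. -/
theorem coeff_scaleVars [Fintype σ] (T : Finset σ) (P : MvPolynomial σ 𝕜) (β : σ →₀ ℕ) :
    MvPolynomial.coeff β ((scaleVars T P).coeff (∑ i ∈ T, β i)) = MvPolynomial.coeff β P := by
  induction P using MvPolynomial.induction_on' with
  | add f g hf hg =>
    rw [map_add, Polynomial.coeff_add, MvPolynomial.coeff_add, MvPolynomial.coeff_add, hf, hg]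
  | monomial m c =>
    rw [scaleVars_monomial, Polynomial.coeff_C_mul_X_pow, MvPolynomial.coeff_monomial]
    split_ifs with h1 h2 h2
    · rw [MvPolynomial.coeff_monomial, if_pos h2]
    · rw [MvPolynomial.coeff_monomial, if_neg h2]
    · exact absurd (by rw [h2]) h1
    · rw [MvPolynomial.coeff_zero]

/-- The variables, with those in `T` scaled, in a field with a place at infinity. -/
def scaledVar (𝕜 : Type*) [Field 𝕜] (T : Finset σ) (i : σ) :
    RatFunc (FractionRing (MvPolynomial σ 𝕜)) :=
  RatFunc.C (algebraMap (MvPolynomial σ 𝕜) _ (MvPolynomial.X i)) * if i ∈ T then RatFunc.X else 1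

theorem aeval_scaledVar (T : Finset σ) (P : MvPolynomial σ 𝕜) :
    MvPolynomial.aeval (scaledVar 𝕜 T) P =
      algebraMap _ (RatFunc (FractionRing (MvPolynomial σ 𝕜)))
        ((scaleVars T P).map (algebraMap _ (FractionRing (MvPolynomial σ 𝕜)))) := by
  induction P using MvPolynomial.induction_on with
  | C a =>
    rw [MvPolynomial.aeval_C, scaleVars, MvPolynomial.coe_eval₂Hom, MvPolynomial.eval₂_C,
      RingHom.comp_apply, Polynomial.map_C, RatFunc.algebraMap_C,
      IsScalarTower.algebraMap_apply 𝕜 (FractionRing (MvPolynomial σ 𝕜)),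
      IsScalarTower.algebraMap_apply 𝕜 (MvPolynomial σ 𝕜) (FractionRing (MvPolynomial σ 𝕜))]
    rfl
  | add f g hf hg => rw [map_add, hf, hg, map_add, Polynomial.map_add, map_add]
  | mul_X f i hf =>
    rw [map_mul, hf, map_mul, Polynomial.map_mul, map_mul, MvPolynomial.aeval_X]
    congr 1
    rw [scaleVars, MvPolynomial.coe_eval₂Hom, MvPolynomial.eval₂_X, Polynomial.map_mul, map_mul,
      Polynomial.map_C, RatFunc.algebraMap_C, scaledVar]
    split_ifs <;> simp

variable [DecidableEq (RatFunc (FractionRing (MvPolynomial σ 𝕜)))]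

open WithZero in
theorem coeff_eq_zero_of_valuation_le [Fintype σ] (T : Finset σ) (P : MvPolynomial σ 𝕜) (d : ℕ)
    (h : RatFunc.inftyValuation _ (MvPolynomial.aeval (scaledVar 𝕜 T) P) ≤ exp (d : ℤ))
    (β : σ →₀ ℕ) (hβ : d < ∑ i ∈ T, β i) : MvPolynomial.coeff β P = 0 := by
  rw [← coeff_scaleVars T P β]
  set p := (scaleVars T P).map (algebraMap _ (FractionRing (MvPolynomial σ 𝕜))) with hp
  have h1 : p.coeff (∑ i ∈ T, β i) = 0 := by
    by_cases hp0 : p = 0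
    · rw [hp0, Polynomial.coeff_zero]
    · rw [aeval_scaledVar, ← hp, RatFunc.inftyValuation_apply,
        RatFunc.inftyValuation.polynomial _ hp0, exp_le_exp] at h
      exact Polynomial.coeff_eq_zero_of_natDegree_lt (by omega)
  rw [hp, Polynomial.coeff_map] at h1
  rw [(map_eq_zero_iff _ (IsFractionRing.injective _ _)).mp h1, MvPolynomial.coeff_zero]

open WithZero in
theorem inftyValuation_scaledVar (T : Finset σ) (i : σ) :
    RatFunc.inftyValuation _ (scaledVar 𝕜 T i) = exp (if i ∈ T then 1 else 0 : ℤ) := by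
  have hX : algebraMap (MvPolynomial σ 𝕜) (FractionRing (MvPolynomial σ 𝕜))
      (MvPolynomial.X i) ≠ 0 := by
    rw [Ne, map_eq_zero_iff _ (IsFractionRing.injective _ _)]
    exact MvPolynomial.X_ne_zero i
  rw [scaledVar, map_mul, RatFunc.inftyValuation.C _ hX, one_mul]
  split_ifs
  · rw [RatFunc.inftyValuation.X]
  · simp

open WithZero in
-- If `i` and `j` are on the same side of `T`, the leading coefficient `y_i - y_j` is nonzero;
-- otherwise the two valuations differ.
theorem inftyValuation_scaledVar_sub (T : Finset σ) (i j : σ) (hij : i ≠ j) :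
    RatFunc.inftyValuation _ (scaledVar 𝕜 T i - scaledVar 𝕜 T j) =
      max (RatFunc.inftyValuation _ (scaledVar 𝕜 T i))
        (RatFunc.inftyValuation _ (scaledVar 𝕜 T j)) := by
  have hX : algebraMap (MvPolynomial σ 𝕜) (FractionRing (MvPolynomial σ 𝕜))
      (MvPolynomial.X i) - algebraMap (MvPolynomial σ 𝕜) _ (MvPolynomial.X j) ≠ 0 := by
    rw [Ne, sub_eq_zero, (IsFractionRing.injective (MvPolynomial σ 𝕜)
      (FractionRing (MvPolynomial σ 𝕜))).eq_iff]
    exact fun h => hij (MvPolynomial.X_injective (R := 𝕜) h)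
  by_cases h : i ∈ T ↔ j ∈ T
  · have h1 : scaledVar 𝕜 T i - scaledVar 𝕜 T j = RatFunc.C (algebraMap (MvPolynomial σ 𝕜) _
        (MvPolynomial.X i) - algebraMap (MvPolynomial σ 𝕜) _ (MvPolynomial.X j)) *
          if i ∈ T then RatFunc.X else 1 := by
      simp only [scaledVar, map_sub, h, sub_mul]
    rw [inftyValuation_scaledVar, inftyValuation_scaledVar, h1, map_mul,
      RatFunc.inftyValuation.C _ hX, one_mul]
    simp only [h, max_self]
    split_ifs
    · rw [RatFunc.inftyValuation.X]
    · simp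
  · rw [sub_eq_add_neg, Valuation.map_add_of_distinct_val, Valuation.map_neg]
    rw [Valuation.map_neg, inftyValuation_scaledVar, inftyValuation_scaledVar, Ne, exp_inj]
    by_cases hi : i ∈ T <;> by_cases hj : j ∈ T <;> simp_all

theorem scaledVar_ne_zero (T : Finset σ) (i : σ) : scaledVar 𝕜 T i ≠ 0 := by
  rw [← (RatFunc.inftyValuation _).ne_zero_iff, inftyValuation_scaledVar]
  exact WithZero.exp_ne_zero

theorem scaledVar_injective (T : Finset σ) : Function.Injective (scaledVar 𝕜 T) := by
  intro i j h
  by_contra hij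
  have h1 := inftyValuation_scaledVar_sub (𝕜 := 𝕜) T i j hij
  rw [h, sub_self, map_zero, max_self, eq_comm, Valuation.zero_iff] at h1
  exact scaledVar_ne_zero T j h1

theorem inftyValuation_algebraMap_le_one (c : 𝕜) :
    RatFunc.inftyValuation _
      (algebraMap 𝕜 (RatFunc (FractionRing (MvPolynomial σ 𝕜))) c) ≤ 1 := by
  have h : algebraMap 𝕜 (RatFunc (FractionRing (MvPolynomial σ 𝕜))) c =
      RatFunc.C (algebraMap 𝕜 (FractionRing (MvPolynomial σ 𝕜)) c) := by
    rw [IsScalarTower.algebraMap_apply 𝕜 (FractionRing (MvPolynomial σ 𝕜))]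
    rfl
  rw [h]
  by_cases hc : algebraMap 𝕜 (FractionRing (MvPolynomial σ 𝕜)) c = 0
  · simp [hc]
  · rw [RatFunc.inftyValuation.C _ hc]

end Scaling

/-! ### Triangularity -/

theorem coe_partList {n : ℕ} (lam : n.Partition) : (partList lam : Multiset ℕ) = lam.parts :=
  Multiset.sort_eq _ _

theorem partList_pos {n : ℕ} (lam : n.Partition) : ∀ x ∈ partList lam, 0 < x := fun x hx =>
  lam.parts_pos (by rwa [← coe_partList, Multiset.mem_coe])

theorem partList_pairwise {n : ℕ} (lam : n.Partition) : (partList lam).Pairwise (· ≥ ·) :=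
  Multiset.pairwise_sort _ _

/-- The parts of a partition as an exponent vector. -/
def partExponent {n : ℕ} (lam : n.Partition) : Fin (partList lam).length →₀ ℕ :=
  Finsupp.equivFunOnFinite.symm (partList lam).get

theorem qProd_eq_prod {n : ℕ} (mu : n.Partition) : qProd mu = ∏ i, qNat (partExponent mu i) := by
  have h : (partList mu).map qNat =
      List.ofFn fun i : Fin (partList mu).length => qNat ((partList mu).get i) := by
    conv_lhs => rw [← List.ofFn_get (partList mu), List.map_ofFn]
    rfl
  rw [qProd, ← coe_partList, Multiset.map_coe, Multiset.prod_coe, h, List.prod_ofFn]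
  rfl

theorem sum_partExponent {n : ℕ} (mu : n.Partition) (k : ℕ) :
    ∑ i with i.val < k, partExponent mu i = ((partList mu).take k).sum := by
  conv_rhs => rw [← List.ofFn_get (partList mu), List.sum_take_ofFn]
  rfl

theorem sum_take_mono (L : List ℕ) {a b : ℕ} (h : a ≤ b) :
    (L.take a).sum ≤ (L.take b).sum :=
  (List.take_sublist_take_left h).sum_le_sum fun _ _ => Nat.zero_le _

theorem B_eq_zero_of_not_domLE {n : ℕ} (nu mu : n.Partition) (h : ¬DomLE mu nu) :
    B nu mu = 0 := by
  classical
  unfold DomLE at h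
  push Not at h
  obtain ⟨k, hk⟩ := h
  set T : Finset (Fin (partList mu).length) := univ.filter fun i => i.val < k with hT
  rw [B, qProd_eq_prod, form_prod_qNat]
  refine coeff_eq_zero_of_valuation_le T _ ((partList nu).take k).sum ?_ _
    (hk.trans_eq (sum_partExponent mu k).symm)
  rw [map_ev]
  simp only [MvPolynomial.aeval_X]
  refine (valuation_ev_Qseq_le _ _ (scaledVar_injective T) (scaledVar_ne_zero T) T
    inftyValuation_algebraMap_le_one (inftyValuation_scaledVar T)
    (inftyValuation_scaledVar_sub T) _ (partList_pairwise nu) (partList_pos nu) univ).trans ?_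
  rw [WithZero.exp_le_exp, univ_inter]
  -- Strict inequality occurs when `mu` has fewer than `k` parts.
  have hcard : #T ≤ k := by
    rw [hT, ← card_map Fin.valEmbedding]
    refine (card_le_card fun x hx => ?_).trans_eq (card_range k)
    obtain ⟨i, hi, rfl⟩ := Finset.mem_map.mp hx
    exact mem_range.mpr (mem_filter.mp hi).2
  exact_mod_cast sum_take_mono _ hcard

/-- Positivity is essential: partial sums do not see trailing zeros. -/
theorem eq_of_sum_take_eq (L₁ L₂ : List ℕ) (h₁ : ∀ x ∈ L₁, 0 < x) (h₂ : ∀ x ∈ L₂, 0 < x)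
    (h : ∀ i, (L₁.take i).sum = (L₂.take i).sum) : L₁ = L₂ := by
  induction L₁ generalizing L₂ with
  | nil =>
    cases L₂ with
    | nil => rfl
    | cons b L₂ =>
      have := h 1
      have := h₂ b (by simp)
      simp_all
  | cons a L₁ ih =>
    cases L₂ with
    | nil =>
      have := h 1
      have := h₁ a (by simp)
      simp_all
    | cons b L₂ =>
      have hab : a = b := by simpa using h 1
      subst hab
      rw [ih L₂ (fun x hx => h₁ x (by simp [hx])) (fun x hx => h₂ x (by simp [hx])) fun i => ?_]
      simpa using h (i + 1)

theorem DomLE.antisymm {n : ℕ} {nu mu : n.Partition} (h₁ : DomLE nu mu) (h₂ : DomLE mu nu) :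
    nu = mu := by
  ext1
  rw [← coe_partList, ← coe_partList, eq_of_sum_take_eq _ _ (partList_pos nu)
    (partList_pos mu) fun i => le_antisymm (h₁ i) (h₂ i)]

end

end HallLittlewood

theorem mainTheorem8 (n : ℕ) :
    (∀ nu mu : n.Partition, HallLittlewood.DomLT nu mu → HallLittlewood.B nu mu = 0) ∧
    (∀ e : n.Partition ≃ Fin (Fintype.card n.Partition),
      (∀ nu mu : n.Partition, HallLittlewood.DomLE nu mu → e nu ≤ e mu) →
        (HallLittlewood.bitraceMatrix n).BlockTriangular e) := by
  refine ⟨fun nu mu h => ?_, fun e he mu nu h => ?_⟩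
  · exact HallLittlewood.B_eq_zero_of_not_domLE nu mu fun h' => h.2 (h.1.antisymm h')
  · exact HallLittlewood.B_eq_zero_of_not_domLE nu mu fun h' => (he mu nu h').not_gt h
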